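/- Let $L$ be a (nonempty) lattice that is semimodular, i.e. for all $a,b\in L$, if $a\wedge b\prec a$ then $b\prec a\vee b$, where $\prec$ is the covering relation. A finite lattice is called join-distributive if for each element $x$ other than the top element, the interval $[x,x^*]$ is a distributive lattice, where $x^*$ is the join of all upper covers of $x$ (an infinite lattice is not join-distributive). $L$ has finite length if the lengths of its finite chains are bounded. A prime interval is an interval $[a,b]$ with $a\prec b$; prime intervals $[a,b]$ and $[c,d]$ are consecutive if $\{a,b,c,d\}$ is a covering square, i.e. a $4$-element boolean sublattice of $L$ such that coverings in it are coverings in $L$. The blocks of the reflexive transitive closure of consecutiveness (an equivalence relation on the set of prime intervals) are called trajectories. Distinct prime intervals $[a,b]$, $[c,d]$ are comparable if $b\le c$ or $d\le a$. The following three conditions are equivalent: (i) $L$ is join-distributive; (ii) $L$ has finite length, and for every trajectory $T$ of $L$ and every maximal chain $C$ of $L$, exactly one prime interval $[a,b]$ with $a,b\in C$ belongs to $T$; (iii) $L$ has finite length, and no two distinct comparable prime intervals of $L$ belong to the same trajectory. Moreover, for semimodular $L$, each of (ii) and (iii) implies that $L$ is finite. -/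

import Mathlib

/-- A lattice is join-distributive if it is finite and, for every `x` other than the top element,
the interval `[x, u]` is a distributive lattice, where `u` is the join of all upper covers of `x`
(that join exists because the lattice is finite and `x` is not the top). -/
def IsJoinDistributive (L : Type*) [Lattice L] : Prop :=
  Finite L ∧ ∀ x : L, ¬ IsTop x → ∃ u : L, IsLUB {y : L | x ⋖ y} u ∧
    ∀ a ∈ Set.Icc x u, ∀ b ∈ Set.Icc x u, ∀ c ∈ Set.Icc x u, a ⊓ (b ⊔ c) = (a ⊓ b) ⊔ (a ⊓ c)

/-- A prime interval `[bot, top]`: an interval whose top covers its bottom. -/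
@[ext]
structure PrimeInterval (L : Type*) [Lattice L] where
  /-- the least element of the interval -/
  bot : L
  /-- the greatest element of the interval -/
  top : L
  covBy : bot ⋖ top

/-- `S` is a covering square: a 4-element boolean sublattice (one isomorphic to `Bool × Bool`)
that is cover-preserving, that is, coverings inside `S` are coverings of the whole lattice. -/
def IsCoveringSquare {L : Type*} [Lattice L] (S : Set L) : Prop :=
  ∃ M : Sublattice L, (M : Set L) = S ∧ Nonempty (M ≃o Bool × Bool) ∧
    ∀ x y : M, x ⋖ y → (x : L) ⋖ (y : L)

namespace PrimeInterval

variable {L : Type*} [Lattice L]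

/-- `[a, b]` and `[c, d]` are consecutive if `{a, b, c, d}` is a covering square. -/
def Consecutive (I J : PrimeInterval L) : Prop :=
  IsCoveringSquare ({I.bot, I.top, J.bot, J.top} : Set L)

theorem Consecutive.symm {I J : PrimeInterval L} (h : Consecutive I J) : Consecutive J I := by
  have e : ({J.bot, J.top, I.bot, I.top} : Set L) = {I.bot, I.top, J.bot, J.top} := by
    ext x
    simp only [Set.mem_insert_iff, Set.mem_singleton_iff]
    tauto
  unfold Consecutive
  rw [e]
  exact h

/-- Two prime intervals are comparable if they are distinct and one lies below the other. -/
def Comparable (I J : PrimeInterval L) : Prop :=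
  I ≠ J ∧ (I.top ≤ J.bot ∨ J.top ≤ I.bot)

/-- The reflexive transitive closure of consecutiveness, which is an equivalence relation. -/
def trajectorySetoid (L : Type*) [Lattice L] : Setoid (PrimeInterval L) where
  r := Relation.ReflTransGen Consecutive
  iseqv :=
    { refl := fun _ => Relation.ReflTransGen.refl
      symm := fun h => by
        induction h with
        | refl => exact Relation.ReflTransGen.refl
        | tail _ h₂ ih => exact Relation.ReflTransGen.head h₂.symm ih
      trans := fun h₁ h₂ => Relation.ReflTransGen.trans h₁ h₂ }

/-- A trajectory is a block of this equivalence relation. -/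
def IsTrajectory (T : Set (PrimeInterval L)) : Prop :=
  T ∈ (trajectorySetoid L).classes

/-- The prime intervals of the lattice with both ends in `C`. For a maximal chain `C` these are
exactly the prime intervals of `C`, since coverings in a maximal chain are coverings in `L`. -/
def ofChain (C : Set L) : Set (PrimeInterval L) :=
  {I | I.bot ∈ C ∧ I.top ∈ C}

end PrimeInterval

/-- The lattice has finite length and every maximal chain meets every trajectory in exactly one
prime interval. -/
def ChainsMeetTrajectoriesOnce (L : Type*) [Lattice L] : Prop :=
  FiniteDimensionalOrder L ∧
    ∀ T : Set (PrimeInterval L), PrimeInterval.IsTrajectory T →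
      ∀ C : Set L, IsMaxChain (· ≤ ·) C → (PrimeInterval.ofChain C ∩ T).encard = 1

/-- The lattice has finite length and no two distinct comparable prime intervals belong to the
same trajectory. -/
def TrajectoriesIncomparable (L : Type*) [Lattice L] : Prop :=
  FiniteDimensionalOrder L ∧
    ∀ T : Set (PrimeInterval L), PrimeInterval.IsTrajectory T →
      ∀ I ∈ T, ∀ J ∈ T, ¬ PrimeInterval.Comparable I J

/-! Everything passes through `NoRelatedComparable`. For join-distributive `L`, the label of `[a,
b]`, the greatest element above `a` but not above `b`, exists and is constant along trajectories; if
`[a, b]` lay below a related interval, the common label would be above `b`.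

Conversely, semimodularity makes a prime interval related to each of its translates `[a, a ⊔ d]`
(`related_sup`). Translating up along a maximal chain shows that the chain meets every trajectory;
it meets it only once because distinct prime intervals of a chain are comparable. Distinct covers of
one element are then unrelated, so they inject into the prime intervals of a finite chain, and `L`
is finite. They are also join-independent (`exists_eq_sup`), which makes `[x, x*]` distributive. -/

namespace FiniteDimensionalOrder

theorem wellFoundedGT (α : Type*) [Preorder α] [FiniteDimensionalOrder α] : WellFoundedGT α :=
  ⟨SetRel.IsWellFounded.inv_of_finiteDimensional {(a, b) : α × α | a < b}⟩

theorem wellFoundedLT (α : Type*) [Preorder α] [FiniteDimensionalOrder α] : WellFoundedLT α :=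
  ⟨SetRel.IsWellFounded.of_finiteDimensional {(a, b) : α × α | a < b}⟩

theorem of_finite (α : Type*) [Preorder α] [Finite α] [Nonempty α] : FiniteDimensionalOrder α := by
  by_contra h
  have := not_finiteDimensionalOrder_iff.1 h
  have := Fintype.ofFinite α
  have hlt := (LTSeries.withLength α (Fintype.card α)).length_lt_card
  rw [LTSeries.length_withLength] at hlt
  exact hlt.false

end FiniteDimensionalOrder

/-- In a well-founded order, an element of a maximal chain below another one has an upper cover
in that chain. -/
theorem IsMaxChain.exists_covBy {α : Type*} [PartialOrder α] [WellFoundedLT α] {C : Set α}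
    (hC : IsMaxChain (· ≤ ·) C) {x y : α} (hx : x ∈ C) (hxy : x < y) :
    ∃ z ∈ C, x ⋖ z := by
  have hne : {z | z ∈ C ∧ x < z}.Nonempty := by
    by_contra hemp
    have hle : ∀ z ∈ C, z ≤ x := fun z hz =>
      (hC.1.total hz hx).elim id fun h =>
        (h.eq_or_lt).elim (fun e => e.ge) fun h => (hemp ⟨z, hz, h⟩).elim
    have hins : IsChain (· ≤ ·) (insert y C) :=
      hC.1.insert fun z hz _ => Or.inr ((hle z hz).trans hxy.le)
    have hy : y ∈ C := by
      rw [hC.2 hins (Set.subset_insert _ _)]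
      exact Set.mem_insert _ _
    exact (hle y hy).not_gt hxy
  obtain ⟨z, ⟨hz, hxz⟩, hmin⟩ := wellFounded_lt.has_min {z | z ∈ C ∧ x < z} hne
  refine ⟨z, hz, hxz, fun w hxw hwz => ?_⟩
  have hins : IsChain (· ≤ ·) (insert w C) := hC.1.insert fun u hu _ => by
    rcases hC.1.total hu hx with h | h
    · exact Or.inr (h.trans hxw.le)
    · rcases h.eq_or_lt with rfl | h
      · exact Or.inr hxw.le
      · rcases hC.1.total hu hz with h' | h'
        · rcases h'.eq_or_lt with rfl | h'
          · exact Or.inl hwz.le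
          · exact (hmin u ⟨hu, h⟩ h').elim
        · exact Or.inl (hwz.le.trans h')
  have hw : w ∈ C := by
    rw [hC.2 hins (Set.subset_insert _ _)]
    exact Set.mem_insert _ _
  exact hmin w ⟨hw, hxw⟩ hwz

theorem CovBy.inf_eq_of_not_le {α : Type*} [Lattice α] {x y z : α} (h : x ⋖ y) (hxz : x ≤ z)
    (hyz : ¬ y ≤ z) : y ⊓ z = x :=
  (h.eq_or_eq (le_inf h.le hxz) inf_le_left).resolve_right fun e => hyz (inf_eq_left.1 e)

theorem CovBy.sup_covBy_sup {α : Type*} [Lattice α] [IsUpperModularLattice α] {x y z : α}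
    (h : x ⋖ y) (hxz : x ≤ z) (hyz : ¬ y ≤ z) : z ⋖ z ⊔ y := by
  have := h.inf_eq_of_not_le hxz hyz
  rw [sup_comm]
  exact covBy_sup_of_inf_covBy_left (this.symm ▸ h)

/-! ### Covering squares and opposite sides -/

namespace PrimeInterval

variable {L : Type*} [Lattice L]

set_option synthInstance.maxHeartbeats 400000 in
set_option synthInstance.maxSize 2000 in
/-- Two disjoint coverings that exhaust `Bool × Bool` are opposite sides of it. -/
theorem bool_square : ∀ p q r s : Bool × Bool, p ≤ q → p ≠ q → r ≤ s → r ≠ s →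
    (∀ t, t = p ∨ t = q ∨ t = r ∨ t = s) →
    (q ⊓ r = p ∧ q ⊔ r = s) ∨ (s ⊓ p = r ∧ s ⊔ p = q) := by
  simp only [Prod.forall, Prod.mk_le_mk, Prod.mk.injEq, Prod.mk_inf_mk, Prod.mk_sup_mk, ne_eq]
  decide +kernel

theorem Consecutive.inf_eq_and_sup_eq {I J : PrimeInterval L} (h : Consecutive I J) :
    (I.top ⊓ J.bot = I.bot ∧ I.top ⊔ J.bot = J.top) ∨
      (J.top ⊓ I.bot = J.bot ∧ J.top ⊔ I.bot = I.top) := by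
  obtain ⟨M, hM, ⟨φ⟩, -⟩ := h
  have hmem : ∀ x, x ∈ M ↔ x = I.bot ∨ x = I.top ∨ x = J.bot ∨ x = J.top := fun x => by
    rw [← SetLike.mem_coe, hM]; simp
  let a : M := ⟨I.bot, by simp [hmem]⟩
  let b : M := ⟨I.top, by simp [hmem]⟩
  let c : M := ⟨J.bot, by simp [hmem]⟩
  let d : M := ⟨J.top, by simp [hmem]⟩
  have hab : a < b := I.covBy.lt
  have hcd : c < d := J.covBy.lt
  have := bool_square (φ a) (φ b) (φ c) (φ d) (φ.monotone hab.le)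
    (φ.injective.ne hab.ne) (φ.monotone hcd.le) (φ.injective.ne hcd.ne) (fun t => by
    have ht := (hmem (φ.symm t)).1 (φ.symm t).2
    have key : ∀ e : M, (φ.symm t : L) = e → t = φ e := fun e he => by
      rw [← Subtype.ext he, φ.apply_symm_apply]
    exact ht.imp (key a) (Or.imp (key b) (Or.imp (key c) (key d))))
  simp only [← map_inf, ← map_sup, φ.injective.eq_iff] at this
  simpa only [Subtype.ext_iff, Sublattice.coe_inf, Sublattice.coe_sup] using this

theorem consecutive_of_inf_eq_of_sup_eq {I J : PrimeInterval L} (hI : I.bot ⋖ J.bot)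
    (hJ : I.top ⋖ J.top) (hinf : I.top ⊓ J.bot = I.bot) (hsup : I.top ⊔ J.bot = J.top) :
    Consecutive I J := by
  obtain ⟨a, b, hab⟩ := I
  obtain ⟨c, d, hcd⟩ := J
  dsimp only at hI hJ hinf hsup
  have hbc : ¬ b ≤ c := fun h => hab.ne' ((inf_eq_left.2 h).symm.trans hinf)
  have hcb : ¬ c ≤ b := fun h => hI.ne' ((inf_eq_right.2 h).symm.trans hinf)
  have had := hab.lt.trans hJ.lt
  let f : Bool × Bool → L := fun p => bif p.1 then (bif p.2 then d else b) else bif p.2 then c else a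
  have hf : ∀ p q, f p ≤ f q ↔ p ≤ q := by
    rintro ⟨_ | _, _ | _⟩ ⟨_ | _, _ | _⟩ <;>
      simp [f, hab.le, hcd.le, hI.le, hJ.le, had.le, hab.lt.not_ge, hcd.lt.not_ge, hI.lt.not_ge,
        hJ.lt.not_ge, had.not_ge, hbc, hcb]
  have hfinf : ∀ p q, f p ⊓ f q = f (p ⊓ q) := by
    rintro ⟨_ | _, _ | _⟩ ⟨_ | _, _ | _⟩ <;>
      simp [f, hab.le, hcd.le, hI.le, hJ.le, had.le, hinf, inf_comm c b]
  have hfsup : ∀ p q, f p ⊔ f q = f (p ⊔ q) := by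
    rintro ⟨_ | _, _ | _⟩ ⟨_ | _, _ | _⟩ <;>
      simp [f, hab.le, hcd.le, hI.le, hJ.le, had.le, hsup, sup_comm c b]
  let M : Sublattice L :=
    { carrier := Set.range f
      supClosed' := by
        rintro _ ⟨p, rfl⟩ _ ⟨q, rfl⟩
        exact ⟨_, (hfsup p q).symm⟩
      infClosed' := by
        rintro _ ⟨p, rfl⟩ _ ⟨q, rfl⟩
        exact ⟨_, (hfinf p q).symm⟩ }
  let g : Bool × Bool ↪o L := OrderEmbedding.ofMapLEIff f hf
  let e : Bool × Bool ≃o M := g.orderIso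
  refine ⟨M, ?_, ⟨e.symm⟩, fun x y hxy => ?_⟩
  · ext x
    change x ∈ Set.range f ↔ _
    simp only [Set.mem_range, Prod.exists, Bool.exists_bool, f, Set.mem_insert_iff, Set.mem_singleton_iff, cond_true, cond_false]
    constructor
    · rintro ((rfl | rfl) | (rfl | rfl)) <;> simp
    · rintro (rfl | rfl | rfl | rfl) <;> simp
  · obtain ⟨p, rfl⟩ := e.surjective x
    obtain ⟨q, rfl⟩ := e.surjective y
    have hpq : p ⋖ q := (apply_covBy_apply_iff e).1 hxy
    change f p ⋖ f q
    clear hxy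
    revert p q
    rintro ⟨_ | _, _ | _⟩ ⟨_ | _, _ | _⟩ h <;>
      simp [Prod.mk_covBy_mk_iff] at h <;> simp [f] <;> first | assumption | exact absurd h (by decide)

/-- The equivalence relation whose blocks are the trajectories. -/
abbrev Related (I J : PrimeInterval L) : Prop := (trajectorySetoid L).r I J

theorem Related.symm {I J : PrimeInterval L} (h : Related I J) : Related J I :=
  (trajectorySetoid L).iseqv.symm h

theorem Related.trans {I J K : PrimeInterval L} (h : Related I J) (h' : Related J K) :
    Related I K :=
  (trajectorySetoid L).iseqv.trans h h'

/-! ### Labels as trajectory invariants -/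

section Labels

/-- `m` is the greatest element above `I.bot` that is not above `I.top`. -/
def IsLabel (I : PrimeInterval L) (m : L) : Prop :=
  ∀ z, I.bot ≤ z → (z ≤ m ↔ ¬ I.top ≤ z)

theorem IsLabel.bot_le {I : PrimeInterval L} {m : L} (h : IsLabel I m) : I.bot ≤ m :=
  (h _ le_rfl).2 I.covBy.lt.not_ge

theorem IsLabel.not_top_le {I : PrimeInterval L} {m : L} (h : IsLabel I m) : ¬ I.top ≤ m :=
  (h _ h.bot_le).1 le_rfl

theorem IsLabel.unique {I : PrimeInterval L} {m n : L} (hm : IsLabel I m) (hn : IsLabel I n) :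
    m = n :=
  le_antisymm ((hn _ hm.bot_le).2 hm.not_top_le) ((hm _ hn.bot_le).2 hn.not_top_le)

theorem IsLabel.of_perspective {I J : PrimeInterval L} {m : L} (h : IsLabel I m)
    (hinf : I.top ⊓ J.bot = I.bot) (hsup : I.top ⊔ J.bot = J.top) : IsLabel J m := fun z hz => by
  have hb : I.bot ≤ J.bot := hinf ▸ inf_le_right
  rw [h z (hb.trans hz), ← hsup, sup_le_iff, and_iff_left hz]

/-- Labels pass up a square directly. They pass down because the lower side has some label, which
also labels the upper side and is unique there. -/
theorem Related.isLabel_iff {I J : PrimeInterval L} (hex : ∀ K : PrimeInterval L, ∃ m, IsLabel K m)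
    (h : Related I J) (m : L) : IsLabel I m ↔ IsLabel J m := by
  have key : ∀ {I J : PrimeInterval L}, I.top ⊓ J.bot = I.bot → I.top ⊔ J.bot = J.top →
      (IsLabel I m ↔ IsLabel J m) := fun {I J} hinf hsup => by
    refine ⟨fun h => h.of_perspective hinf hsup, fun h => ?_⟩
    obtain ⟨n, hn⟩ := hex I
    rwa [h.unique (hn.of_perspective hinf hsup)]
  induction h with
  | refl => rfl
  | tail _ h ih =>
    refine ih.trans ?_
    rcases h.inf_eq_and_sup_eq with ⟨h₁, h₂⟩ | ⟨h₁, h₂⟩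
    · exact key h₁ h₂
    · exact (key h₁ h₂).symm

/-- Downward induction on the bottom `a`: each other cover `c` of `a` gives a label of `[c, c ⊔ b]`,
and distributivity forces these labels to agree. -/
theorem exists_isLabel [IsUpperModularLattice L] (hL : IsJoinDistributive L)
    (I : PrimeInterval L) : ∃ m, IsLabel I m := by
  obtain ⟨_, hdist⟩ := hL
  obtain ⟨a, b, hab⟩ := I
  induction a using WellFoundedGT.induction generalizing b with
  | ind a ih =>
    have hcov : ∀ c, a ⋖ c → c ≠ b → ¬ b ≤ c := fun c hc hcb h =>
      (hc.eq_or_eq hab.le h).elim hab.ne' hcb.symm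
    have hsq : ∀ c, a ⋖ c → c ≠ b → c ⋖ c ⊔ b := fun c hc hcb =>
      hab.sup_covBy_sup hc.le (hcov c hc hcb)
    have hlab : ∀ c, a ⋖ c → c ≠ b → ∃ m, ∀ z, c ≤ z → (z ≤ m ↔ ¬ b ≤ z) := by
      intro c hc hcb
      obtain ⟨m, hm⟩ := ih c hc.lt (c ⊔ b) (hsq c hc hcb)
      exact ⟨m, fun z hz => by simpa [hz] using hm z hz⟩
    have habove : ∀ z, a ≤ z → ¬ b ≤ z → z ≠ a → ∃ c, a ⋖ c ∧ c ≠ b ∧ c ≤ z := by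
      intro z hz hbz hza
      obtain ⟨c, hc, hcz⟩ := exists_covBy_le_of_lt (hz.lt_of_ne' hza)
      exact ⟨c, hc, fun e => hbz (e ▸ hcz), hcz⟩
    -- If `b` is the only cover of `a`, then `a` is its own label.
    by_cases hone : ∀ c, a ⋖ c → c = b
    · refine ⟨a, fun z hz => ⟨fun h => ?_, fun h => ?_⟩⟩
      · exact fun hb => (hb.trans h).not_gt hab.lt
      · by_contra hza
        obtain ⟨c, hc, hcb, -⟩ := habove z hz h fun e => hza e.le
        exact hcb (hone c hc)
    · push Not at hone
      obtain ⟨c₀, hc₀, hcb₀⟩ := hone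
      obtain ⟨m, hm⟩ := hlab c₀ hc₀ hcb₀
      have hc₀m : c₀ ≤ m := (hm c₀ le_rfl).2 (hcov _ hc₀ hcb₀)
      have hbm : ¬ b ≤ m := (hm m hc₀m).1 le_rfl
      refine ⟨m, fun z hz => ⟨fun h hb => hbm (hb.trans h), fun h => ?_⟩⟩
      by_cases hza : z = a
      · exact hza ▸ hc₀.le.trans hc₀m
      obtain ⟨c, hc, hcb, hcz⟩ := habove z hz h hza
      obtain ⟨n, hn⟩ := hlab c hc hcb
      obtain ⟨u, hu, hd⟩ := hdist a fun ht => (ht b).not_gt hab.lt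
      have hI : ∀ y, a ⋖ y → y ∈ Set.Icc a u := fun y hy => ⟨hy.le, hu.1 hy⟩
      -- Otherwise distributivity gives `b = (b ⊓ c₀) ⊔ (b ⊓ c) = a`.
      have hbcc : ¬ b ≤ c₀ ⊔ c := fun hle => by
        have := hd b (hI b hab) c₀ (hI _ hc₀) c (hI _ hc)
        rw [inf_eq_left.2 hle, hab.inf_eq_of_not_le hc₀.le (hcov _ hc₀ hcb₀),
          hab.inf_eq_of_not_le hc.le (hcov _ hc hcb), sup_idem] at this
        exact hab.ne' this
      have h₁ : c₀ ⊔ c ≤ n := (hn _ le_sup_right).2 hbcc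
      have hbn : ¬ b ≤ n := (hn n (le_sup_right.trans h₁)).1 le_rfl
      exact ((hn z hcz).2 h).trans ((hm n (le_sup_left.trans h₁)).2 hbn)

end Labels

/-- No two comparable prime intervals belong to the same trajectory. -/
def NoRelatedComparable (L : Type*) [Lattice L] : Prop :=
  ∀ I J : PrimeInterval L, Related I J → ¬ I.top ≤ J.bot

theorem noRelatedComparable_of_isJoinDistributive [IsUpperModularLattice L]
    (hL : IsJoinDistributive L) : NoRelatedComparable L := by
  intro I J h hle
  obtain ⟨m, hm⟩ := exists_isLabel hL I
  exact hm.not_top_le (hle.trans ((h.isLabel_iff (exists_isLabel hL) m).1 hm).bot_le)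

theorem trajectories_incomparable_iff :
    (∀ T : Set (PrimeInterval L), IsTrajectory T → ∀ I ∈ T, ∀ J ∈ T, ¬ Comparable I J) ↔
      NoRelatedComparable L := by
  constructor
  · intro h I J hIJ hle
    refine h {K | (trajectorySetoid L).r K J} ⟨J, rfl⟩ I hIJ J ((trajectorySetoid L).iseqv.refl J)
      ⟨?_, Or.inl hle⟩
    rintro rfl
    exact I.covBy.lt.not_ge hle
  · rintro h T ⟨K, rfl⟩ I hI J hJ ⟨-, hle | hle⟩
    · exact h I J (Related.trans hI (Related.symm hJ)) hle
    · exact h J I (Related.trans hJ (Related.symm hI)) hle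

/-! ### Translation, maximal chains and independence of covers -/

section Semimodular

variable [IsUpperModularLattice L]

/-- A prime interval is related to its translates under joins. -/
theorem related_sup [WellFoundedLT L] [WellFoundedGT L] {x d a : L} (hxd : x ⋖ d) (hxa : x ≤ a)
    (hda : ¬ d ≤ a) : Related ⟨x, d, hxd⟩ ⟨a, a ⊔ d, hxd.sup_covBy_sup hxa hda⟩ := by
  induction x using WellFoundedGT.induction generalizing d with
  | ind x ih =>
    rcases hxa.eq_or_lt with rfl | hlt
    · have e : (⟨x, d, hxd⟩ : PrimeInterval L) = ⟨x, x ⊔ d, hxd.sup_covBy_sup hxa hda⟩ := by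
        ext
        · rfl
        · exact (sup_eq_right.2 hxd.le).symm
      exact e ▸ (trajectorySetoid L).iseqv.refl _
    · obtain ⟨y, hxy, hya⟩ := exists_covBy_le_of_lt hlt
      have hdy : ¬ d ≤ y := fun h => hda (h.trans hya)
      have hyd : ¬ y ≤ d := fun h => (hxd.eq_or_eq hxy.le h).elim hxy.ne' fun e => hdy e.ge
      have hy := hxd.sup_covBy_sup hxy.le hdy
      have h₁ : Related ⟨x, d, hxd⟩ ⟨y, y ⊔ d, hy⟩ :=
        Relation.ReflTransGen.single <| consecutive_of_inf_eq_of_sup_eq hxy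
          (by simpa [sup_comm] using hxy.sup_covBy_sup hxd.le hyd)
          (hxd.inf_eq_of_not_le hxy.le hdy) (sup_comm _ _)
      have hda' : ¬ y ⊔ d ≤ a := fun h => hda (le_sup_right.trans h)
      have h₂ := ih y hxy.lt hy hya hda'
      have e : a ⊔ (y ⊔ d) = a ⊔ d := by rw [← sup_assoc, sup_eq_left.2 hya]
      simp only [e] at h₂
      exact h₁.trans h₂

/-- A maximal chain contains a prime interval related to any given one. -/
theorem exists_mem_ofChain_related [WellFoundedLT L] [WellFoundedGT L] {C : Set L}
    (hC : IsMaxChain (· ≤ ·) C) {x : L} (hx : x ∈ C) (I : PrimeInterval L) (hxI : x ≤ I.bot) :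
    ∃ J ∈ ofChain C, Related I J := by
  induction x using WellFoundedGT.induction generalizing I with
  | ind x ih =>
    obtain ⟨d, hd, hxd⟩ := hC.exists_covBy hx (hxI.trans_lt I.covBy.lt)
    -- If `d` is not below `I.bot`, either `[x, d]` translates to `I`, or `I` is translated to an
    -- interval with bottom above `d`, and the climb continues.
    by_cases hdI : d ≤ I.bot
    · exact ih d hxd.lt hd I hdI
    have hcov := hxd.sup_covBy_sup hxI hdI
    by_cases he : I.bot ⊔ d = I.top
    · refine ⟨⟨x, d, hxd⟩, ⟨hx, hd⟩, ?_⟩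
      have := related_sup hxd hxI hdI
      simp only [he] at this
      exact this.symm
    · have hn : ¬ I.top ≤ I.bot ⊔ d := fun h =>
        (hcov.eq_or_eq I.covBy.le h).elim I.covBy.ne' fun e => he e.symm
      obtain ⟨J, hJ, h⟩ := ih d hxd.lt hd
        ⟨I.bot ⊔ d, I.bot ⊔ d ⊔ I.top, I.covBy.sup_covBy_sup le_sup_left hn⟩ le_sup_right
      exact ⟨J, hJ, (related_sup I.covBy le_sup_left hn).trans h⟩

theorem chains_meet_trajectories_once_iff [OrderBot L] [WellFoundedLT L] [WellFoundedGT L] :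
    (∀ T : Set (PrimeInterval L), IsTrajectory T → ∀ C : Set L, IsMaxChain (· ≤ ·) C →
      (ofChain C ∩ T).encard = 1) ↔ NoRelatedComparable L := by
  constructor
  · intro h I J hIJ hle
    have hchain : IsChain (· ≤ ·) ({I.bot, I.top, J.bot, J.top} : Set L) := by
      have h₁ := I.covBy.le
      have h₂ := J.covBy.le
      have h₃ := h₁.trans hle
      have h₄ := hle.trans h₂
      have h₅ := h₃.trans h₂
      rintro _ (rfl | rfl | rfl | rfl) _ (rfl | rfl | rfl | rfl) - <;> simp [*]
    obtain ⟨C, hC, hsub⟩ := hchain.exists_maxChain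
    have hone := h {K | (trajectorySetoid L).r K J} ⟨J, rfl⟩ C hC
    have heq : I = J := Set.encard_le_one_iff.1 hone.le I J
      ⟨⟨hsub (by simp), hsub (by simp)⟩, hIJ⟩
      ⟨⟨hsub (by simp), hsub (by simp)⟩, (trajectorySetoid L).iseqv.refl J⟩
    subst heq
    exact I.covBy.lt.not_ge hle
  · rintro h T ⟨K, rfl⟩ C hC
    obtain ⟨J, hJ, hKJ⟩ := exists_mem_ofChain_related hC hC.bot_mem K bot_le
    refine Set.encard_eq_one.2 ⟨J, Set.eq_singleton_iff_unique_mem.2 ⟨⟨hJ, hKJ.symm⟩, ?_⟩⟩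
    rintro I ⟨hI, hIK⟩
    have hIJ : Related I J := Related.trans hIK hKJ
    have key : ∀ {I J : PrimeInterval L}, I ∈ ofChain C → J ∈ ofChain C → I.bot < J.bot →
        I.top ≤ J.bot := fun {I J} hI hJ hlt => by
      rcases hC.1.total hI.2 hJ.1 with h | h
      · exact h
      · exact (I.covBy.eq_or_eq hlt.le h).elim (fun e => (hlt.ne' e).elim) fun e => e.ge
    have hbot : I.bot = J.bot := by
      rcases hC.1.total hI.1 hJ.1 with hle | hle
      · exact hle.eq_or_lt.resolve_right fun hlt => h I J hIJ (key hI hJ hlt)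
      · exact (hle.eq_or_lt.resolve_right fun hlt => h J I hIJ.symm (key hJ hI hlt)).symm
    refine PrimeInterval.ext hbot ?_
    rcases hC.1.total hI.2 hJ.2 with hle | hle
    · exact (J.covBy.eq_or_eq (hbot ▸ I.covBy.le) hle).resolve_left
        fun e => I.covBy.ne' (e.trans hbot.symm)
    · exact ((I.covBy.eq_or_eq (hbot ▸ J.covBy.le) hle).resolve_left
        fun e => J.covBy.ne' (e.trans hbot)).symm

/-- If `c ≠ d`, then `[x, c]` translates to `[d, d ⊔ c]`, which lies above the related `[x, d]`. -/
theorem NoRelatedComparable.eq_of_related [WellFoundedLT L] [WellFoundedGT L]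
    (hL : NoRelatedComparable L) {x c d : L} {hc : x ⋖ c} {hd : x ⋖ d}
    (h : Related ⟨x, c, hc⟩ ⟨x, d, hd⟩) : c = d := by
  by_contra hcd
  have hcd' : ¬ c ≤ d := fun hle =>
    (hd.eq_or_eq hc.le hle).elim hc.ne' hcd
  exact hL _ _ (h.symm.trans (related_sup hc hd.le hcd')) le_rfl

/-- An upper cover of `x` below `x` joined with finitely many elements, each of which either lies
below `x` or yields an upper cover of `x` when joined to it, is one of these upper covers. -/
theorem NoRelatedComparable.exists_eq_sup [OrderBot L] [WellFoundedLT L] [WellFoundedGT L]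
    (hL : NoRelatedComparable L) {x t : L} (ht : x ⋖ t) (E : Finset L)
    (hE : ∀ e ∈ E, ¬ e ≤ x → x ⋖ x ⊔ e) (hle : t ≤ x ⊔ E.sup id) : ∃ e ∈ E, t = x ⊔ e := by
  classical
  induction E using Finset.induction_on with
  | empty => exact (ht.lt.not_ge (by simpa using hle)).elim
  | insert e E _ ih =>
    by_cases hts : t ≤ x ⊔ E.sup id
    · obtain ⟨f, hf, h⟩ := ih (fun f hf => hE f (Finset.mem_insert_of_mem hf)) hts
      exact ⟨f, Finset.mem_insert_of_mem hf, h⟩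
    refine ⟨e, Finset.mem_insert_self _ _, ?_⟩
    set s := x ⊔ E.sup id with hs
    have hxs : x ≤ s := le_sup_left
    have hle' : t ≤ s ⊔ (x ⊔ e) := by
      refine hle.trans ?_
      rw [Finset.sup_insert, id, hs]
      exact sup_le (le_sup_left.trans le_sup_left)
        (sup_le (le_sup_right.trans le_sup_right) (le_sup_right.trans le_sup_left))
    have hes : ¬ x ⊔ e ≤ s := fun h => hts (hle'.trans (sup_le le_rfl h))
    have hxe : x ⋖ x ⊔ e := hE e (Finset.mem_insert_self _ _) fun h => hes (by simpa [h] using hxs)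
    have h₁ := related_sup ht hxs hts
    have h₂ := related_sup hxe hxs hes
    -- Both `t` and `x ⊔ e` translate to the same cover of `s`.
    have e₁ : s ⊔ t = s ⊔ (x ⊔ e) :=
      ((hxe.sup_covBy_sup hxs hes).eq_or_eq le_sup_left (sup_le le_sup_left hle')).resolve_left
        (ht.sup_covBy_sup hxs hts).ne'
    simp only [e₁] at h₁
    exact hL.eq_of_related (h₁.trans h₂.symm)

theorem NoRelatedComparable.finite_covers [OrderBot L] [WellFoundedLT L] [WellFoundedGT L]
    (hL : NoRelatedComparable L) (x : L) : {y | x ⋖ y}.Finite := by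
  classical
  obtain ⟨C, hC, -⟩ := (IsChain.empty : IsChain (· ≤ ·) (∅ : Set L)).exists_maxChain
  have : Finite (Flag.ofIsMaxChain C hC) := Finite.of_wellFoundedLT_wellFoundedGT _
  have hCfin : Finite C := this
  choose f hf hrel using fun c : {y | x ⋖ y} =>
    exists_mem_ofChain_related hC hC.bot_mem ⟨x, c, c.2⟩ bot_le
  let g : {y | x ⋖ y} → C × C := fun c => (⟨(f c).bot, (hf c).1⟩, ⟨(f c).top, (hf c).2⟩)
  have hg : Function.Injective g := fun c d hcd => by
    simp only [g, Prod.mk.injEq, Subtype.mk.injEq] at hcd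
    have hfe : f c = f d := PrimeInterval.ext hcd.1 hcd.2
    exact Subtype.ext (hL.eq_of_related ((hrel c).trans (hfe ▸ (hrel d).symm)))
  exact Finite.of_injective g hg

theorem NoRelatedComparable.finite [OrderBot L] [WellFoundedLT L] [WellFoundedGT L]
    (hL : NoRelatedComparable L) : Finite L := by
  have key : ∀ x : L, (Set.Ici x).Finite := fun x => by
    induction x using WellFoundedGT.induction with
    | ind x ih =>
      refine (((hL.finite_covers x).biUnion fun c hc => ih c (CovBy.lt hc)).insert x).subset ?_
      intro y hy
      rcases (Set.mem_Ici.1 hy).eq_or_lt with rfl | hlt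
      · exact Set.mem_insert _ _
      · obtain ⟨c, hc, hcy⟩ := exists_covBy_le_of_lt hlt
        exact Set.mem_insert_of_mem _ (Set.mem_biUnion hc hcy)
  exact Set.finite_univ_iff.1 (by simpa using key ⊥)

theorem NoRelatedComparable.isJoinDistributive [OrderBot L] [WellFoundedLT L] [WellFoundedGT L]
    (hL : NoRelatedComparable L) : IsJoinDistributive L := by
  classical
  have := hL.finite
  refine ⟨this, fun x hx => ?_⟩
  let A := (hL.finite_covers x).toFinset
  have hA : ∀ {c}, c ∈ A ↔ x ⋖ c := by simp [A]
  have hlub : IsLUB {y | x ⋖ y} (A.sup id) := by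
    have := A.isLUB_sup_id
    simpa [A] using this
  refine ⟨A.sup id, hlub, ?_⟩
  -- Every element of the interval is the join of `x` and the covers below it: a gap would contain a
  -- step `s ⋖ s ⊔ e` with `e` a cover already counted in `s`.
  have hrep : ∀ y ∈ Set.Icc x (A.sup id), y = x ⊔ (A.filter (· ≤ y)).sup id := by
    rintro y ⟨hxy, hyu⟩
    by_contra hne
    set s := x ⊔ (A.filter (· ≤ y)).sup id with hs
    have hsy : s ≤ y := sup_le hxy (Finset.sup_le fun c hc => (Finset.mem_filter.1 hc).2)
    obtain ⟨t, hst, hty⟩ := exists_covBy_le_of_lt (hsy.lt_of_ne' hne)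
    obtain ⟨e, he, rfl⟩ := hL.exists_eq_sup hst A
      (fun e he hes => (hA.1 he).sup_covBy_sup le_sup_left hes)
      (hty.trans (hyu.trans le_sup_right))
    have hes : e ≤ s := le_trans (b := (A.filter (· ≤ y)).sup id)
      (Finset.le_sup (f := id) (Finset.mem_filter.2 ⟨he, le_sup_right.trans hty⟩)) le_sup_right
    exact hst.lt.not_ge (sup_le le_rfl hes)
  intro a ha b hb c hc
  have hle : a ⊓ (b ⊔ c) ∈ Set.Icc x (A.sup id) :=
    ⟨le_inf ha.1 (hb.1.trans le_sup_left), inf_le_left.trans ha.2⟩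
  refine le_antisymm ?_ le_inf_sup
  rw [hrep _ hle]
  refine sup_le ((le_inf ha.1 hb.1).trans le_sup_left) (Finset.sup_le fun e he => ?_)
  obtain ⟨heA, hea⟩ := Finset.mem_filter.1 he
  have hxe := hA.1 heA
  have hbc : b ⊔ c = x ⊔ (A.filter (· ≤ b) ∪ A.filter (· ≤ c)).sup id := by
    rw [Finset.sup_union, sup_sup_distrib_left, ← hrep b hb, ← hrep c hc]
  -- By independence, a cover below `b ⊔ c` is already below `b` or below `c`.
  obtain ⟨f, hf, hef⟩ := hL.exists_eq_sup hxe (A.filter (· ≤ b) ∪ A.filter (· ≤ c))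
    (fun f hf hfx => by
      have : f ∈ A := by
        rcases Finset.mem_union.1 hf with h | h <;> exact (Finset.mem_filter.1 h).1
      exact (hA.1 this).sup_covBy_sup le_rfl hfx)
    (hbc ▸ hea.trans inf_le_right)
  have hea' : e ≤ a := hea.trans inf_le_left
  rcases Finset.mem_union.1 hf with h | h
  · exact le_sup_of_le_left (le_inf hea' (hef ▸ sup_le hb.1 (Finset.mem_filter.1 h).2))
  · exact le_sup_of_le_right (le_inf hea' (hef ▸ sup_le hc.1 (Finset.mem_filter.1 h).2))

end Semimodular

end PrimeInterval

/-- A nonempty lattice that is well-founded has a least element. -/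
theorem exists_isBot_of_wellFoundedLT (L : Type*) [Lattice L] [Nonempty L] [WellFoundedLT L] :
    ∃ b : L, IsBot b := by
  obtain ⟨b, -, hb⟩ := wellFounded_lt.has_min (Set.univ : Set L) Set.univ_nonempty
  exact ⟨b, fun y => inf_eq_left.1 (inf_le_left.eq_or_lt.resolve_right (hb (b ⊓ y) trivial))⟩

/-! ### The equivalences -/

theorem chainsMeetTrajectoriesOnce_iff_trajectoriesIncomparable {L : Type*} [Lattice L]
    [Nonempty L] [IsUpperModularLattice L] :
    ChainsMeetTrajectoriesOnce L ↔ TrajectoriesIncomparable L := by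
  refine and_congr_right fun hfin => ?_
  have := FiniteDimensionalOrder.wellFoundedGT L
  have := FiniteDimensionalOrder.wellFoundedLT L
  obtain ⟨b, hb⟩ := exists_isBot_of_wellFoundedLT L
  let _ : OrderBot L := { bot := b, bot_le := hb }
  rw [PrimeInterval.trajectories_incomparable_iff, PrimeInterval.chains_meet_trajectories_once_iff]

theorem isJoinDistributive_iff_trajectoriesIncomparable {L : Type*} [Lattice L]
    [Nonempty L] [IsUpperModularLattice L] :
    IsJoinDistributive L ↔ TrajectoriesIncomparable L := by
  constructor
  · intro h
    have := h.1
    exact ⟨.of_finite L, PrimeInterval.trajectories_incomparable_iff.2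
      (PrimeInterval.noRelatedComparable_of_isJoinDistributive h)⟩
  · rintro ⟨hfin, h⟩
    have := FiniteDimensionalOrder.wellFoundedGT L
    have := FiniteDimensionalOrder.wellFoundedLT L
    obtain ⟨b, hb⟩ := exists_isBot_of_wellFoundedLT L
    let _ : OrderBot L := { bot := b, bot_le := hb }
    exact (PrimeInterval.trajectories_incomparable_iff.1 h).isJoinDistributive

theorem corollary2 {L : Type*} [Lattice L] [Nonempty L] [IsUpperModularLattice L] :
    List.TFAE
      [IsJoinDistributive L,
       ChainsMeetTrajectoriesOnce L,
       TrajectoriesIncomparable L] ∧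
    (ChainsMeetTrajectoriesOnce L → Finite L) ∧
    (TrajectoriesIncomparable L → Finite L) := by
  have h₁ := isJoinDistributive_iff_trajectoriesIncomparable (L := L)
  have h₂ := chainsMeetTrajectoriesOnce_iff_trajectoriesIncomparable (L := L)
  refine ⟨?_, fun h => (h₁.2 (h₂.1 h)).1, fun h => (h₁.2 h).1⟩
  tfae_have 1 ↔ 3 := h₁
  tfae_have 2 ↔ 3 := h₂
  tfae_finish
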